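/- Let $S$ be a finite set and, for every $\lambda>0$, let $Q(\lambda)=(q_{ij}(\lambda))$ be an irreducible transition rate matrix on $S$, with $q_i(\lambda)=-q_{ii}(\lambda)$. Assume that, as $\lambda\to\infty$, every $q_{ij}(\lambda)$ with $i\ne j$ has a finite limit or tends to $\infty$. Let $A$ be the set of fast states, those with $q_i(\lambda)\to\infty$, and let $B=S\setminus A$ be the set of slow states, those for which $q_i=\lim_{\lambda\to\infty}q_i(\lambda)$ is finite; assume that $B\neq\emptyset$ and that $q_i>0$ for every $i\in B$. Let $\Omega(\lambda)=(\omega_{ij}(\lambda))$ be the jump matrix, $\omega_{ij}(\lambda)=q_{ij}(\lambda)/q_i(\lambda)$ for $i\neq j$ and $\omega_{ii}(\lambda)=0$; assume that $\Omega=\lim_{\lambda\to\infty}\Omega(\lambda)$ exists, and that the discrete-time Markov chain with transition matrix $\Omega$, started from any $i\in A$, almost surely reaches $B$. For a probability distribution $\pi$ on $S$, let $X=(X_t)_{t\ge0}$ be, under $P^\lambda_\pi$, the right-continuous Markov chain on $S$ with transition rate matrix $Q(\lambda)$ and initial law $\pi$, and let $\tau_B=\inf\{t\ge0: X_t\in B\}$.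 Let $d_{TV}(\mu,\nu)=\frac12\sum_{i\in S}|\mu_i-\nu_i|$. Then for every probability distribution $\pi$ on $S$ and every $\varepsilon>0$ there are deterministic times $t(\lambda,\varepsilon)>0$ ($\lambda>0$) with $\lim_{\lambda\to\infty}t(\lambda,\varepsilon)=0$ such that, for all sufficiently large $\lambda$, $$d_{TV}\bigl(P^\lambda_\pi(X_{t(\lambda,\varepsilon)}\in\cdot),\,P^\lambda_\pi(X_{\tau_B}\in\cdot)\bigr)\le\varepsilon ,$$ and in particular $P^\lambda_\pi(X_{t(\lambda,\varepsilon)}\in B)\ge 1-\varepsilon$. -/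

import Mathlib

open Filter Topology MeasureTheory
open scoped NNReal ENNReal

noncomputable section

namespace TwoTimeScale

/-- Transition rate matrices: non-negative off-diagonal entries and zero row sums. -/
def IsRateMatrix {S : Type*} [Fintype S] (q : Matrix S S ℝ) : Prop :=
  (∀ i j, i ≠ j → 0 ≤ q i j) ∧ ∀ i, ∑ j, q i j = 0

/-- Irreducibility of a rate matrix: any state leads to any other one along positive rates. -/
def IsIrreducibleRate {S : Type*} (q : Matrix S S ℝ) : Prop :=
  ∀ i j, Relation.ReflTransGen (fun a b => 0 < q a b) i j

/-- The total rate `q_i = -q_{ii}` of leaving the state `i`. -/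
def exitRate {S : Type*} (q : Matrix S S ℝ) (i : S) : ℝ := -q i i

/-- The transition matrix of the jump chain of a rate matrix without absorbing states. -/
def jumpMatrix {S : Type*} [DecidableEq S] (q : Matrix S S ℝ) : Matrix S S ℝ :=
  Matrix.of fun i j => if i = j then 0 else q i j / exitRate q i

/-- States whose exit rate tends to infinity with the parameter. -/
def fastStates {S : Type*} (Q : ℝ → Matrix S S ℝ) : Set S :=
  {i | Tendsto (fun lam => exitRate (Q lam) i) atTop atTop}

/-- States whose exit rate has a finite limit as the parameter tends to infinity. -/
def slowStates {S : Type*} (Q : ℝ → Matrix S S ℝ) : Set S :=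
  {i | ∃ l : ℝ, Tendsto (fun lam => exitRate (Q lam) i) atTop (𝓝 l)}

/-- `Y` is, under `P`, a discrete-time Markov chain with initial law `ν` and transition
matrix `p`. -/
structure IsDiscreteMarkovChain {S Ω : Type*} [MeasurableSpace Ω] (p : Matrix S S ℝ)
    (ν : S → ℝ) (P : Measure Ω) (Y : ℕ → Ω → S) : Prop where
  measurable : ∀ n j, MeasurableSet {ω | Y n ω = j}
  law : ∀ (n : ℕ) (i : ℕ → S), P.real {ω | ∀ k ≤ n, Y k ω = i k} =
    ν (i 0) * ∏ k ∈ Finset.range n, p (i k) (i (k + 1))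

/-- The first-passage time `inf {n ≥ 0 : y n ∈ B}` of a discrete-time path (`⊤` if there is none). -/
def discretePassageTime {S : Type*} (B : Set S) (y : ℕ → S) : ℕ∞ :=
  ⨅ (n : ℕ) (_ : y n ∈ B), (n : ℕ∞)

/-- The jump times `J_0 = 0`, `J_{n+1} = inf {t ≥ J_n : x t ≠ x (J_n)}` of a path
(`inf ∅ = ⊤`, and all later jump times are then `⊤` too). -/
def jumpTime {S : Type*} (x : ℝ≥0 → S) : ℕ → ℝ≥0∞
  | 0 => 0
  | n + 1 => ⨅ (t : ℝ≥0) (_ : jumpTime x n ≤ t ∧ x t ≠ x (jumpTime x n).toNNReal), (t : ℝ≥0∞)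

/-- The states `x (J_n)` visited by a path. -/
def jumpChain {S : Type*} (x : ℝ≥0 → S) (n : ℕ) : S := x (jumpTime x n).toNNReal

/-- The holding times `J_{n+1} - J_n` of a path. -/
def holdingTime {S : Type*} (x : ℝ≥0 → S) (n : ℕ) : ℝ≥0∞ := jumpTime x (n + 1) - jumpTime x n

/-- `X` is, under `P`, a continuous-time Markov chain with initial law `ν` and transition rate
matrix `q` (all of whose exit rates are positive): a right-continuous process whose jump chain is
a Markov chain with initial law `ν` and the transition matrix given by `q`, and whose holding
times are, conditionally on the jump chain, independent and exponential with the exit rates of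
the visited states as parameters. -/
structure IsMarkovChain {S Ω : Type*} [DecidableEq S] [MeasurableSpace Ω] (q : Matrix S S ℝ)
    (ν : S → ℝ) (P : Measure Ω) (X : ℝ≥0 → Ω → S) : Prop where
  measurable : ∀ t j, MeasurableSet {ω | X t ω = j}
  rightContinuous : ∀ ω t, ∀ᶠ s in 𝓝[≥] t, X s ω = X t ω
  jumpChain_law : IsDiscreteMarkovChain (jumpMatrix q) ν P fun n ω => jumpChain (X · ω) n
  measurable_holdingTime : ∀ n, Measurable fun ω => holdingTime (X · ω) n
  holdingTime_law : ∀ (n : ℕ) (i : ℕ → S) (s : ℕ → ℝ≥0),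
    P.real {ω | ∀ k ≤ n, jumpChain (X · ω) k = i k ∧ (s k : ℝ≥0∞) < holdingTime (X · ω) k} =
      P.real {ω | ∀ k ≤ n, jumpChain (X · ω) k = i k} *
        ∏ k ∈ Finset.range (n + 1), Real.exp (-(exitRate q (i k) * s k))

/-- The first-passage time `inf {t ≥ 0 : x t ∈ B}` of a path (`⊤` if there is none). -/
def passageTime {S : Type*} (B : Set S) (x : ℝ≥0 → S) : ℝ≥0∞ :=
  ⨅ (t : ℝ≥0) (_ : x t ∈ B), (t : ℝ≥0∞)

/-- The law of `X` at time `t`, as a family of point masses. -/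
def marginalLaw {S Ω : Type*} [MeasurableSpace Ω] (P : Measure Ω) (X : ℝ≥0 → Ω → S) (t : ℝ≥0)
    (j : S) : ℝ :=
  P.real {ω | X t ω = j}

/-- The law of `X` at its first passage into `B`, as a family of point masses. -/
def firstPassageLaw {S Ω : Type*} [MeasurableSpace Ω] (P : Measure Ω) (X : ℝ≥0 → Ω → S)
    (B : Set S) (j : S) : ℝ :=
  P.real {ω | passageTime B (X · ω) < ⊤ ∧ X (passageTime B (X · ω)).toNNReal ω = j}

/-- The total variation distance on a finite set. -/
def dTV {S : Type*} [Fintype S] (μ ν : S → ℝ) : ℝ := (1 / 2) * ∑ i, |μ i - ν i|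

end TwoTimeScale

end

open TwoTimeScale

/-! Pick a time scale `t` tending to 0 so slowly that `q_i * t → ∞` for every fast state: visits to
fast states are short compared with `t`, while visits to slow states last far longer. If the jump
chain enters the slow set within `N` jumps, each fast visit lasts at most `t / (N + 1)`, and each
slow visit exceeds `t`, then at time `t` the chain still sits in the slow state where it entered
(`eq_at_passageTime`, a pathwise fact). A union bound over steps and states gives
`entranceErrorBound` for the failure probability. With `N` fixed, its exponential terms vanish as
`lam → ∞`, and what remains is the probability that the limiting jump chain avoids the slow set for
`N` steps (`tendsto_entranceErrorBound`). Almost sure absorption makes this small for large `N`.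
Only `N` depends on `ε`; the time scale does not. -/

namespace TwoTimeScale

/-! ### Discrete-time chains: finite path expansions and avoidance probabilities -/

section Paths

/-- The infinite path which follows a finite path and then stays at its last state. -/
def extendPath {S : Type*} {n : ℕ} (c : Fin (n + 1) → S) (k : ℕ) : S :=
  c ⟨min k n, Nat.lt_succ_of_le (min_le_right k n)⟩

theorem forall_eq_extendPath_iff {S : Type*} {n : ℕ} (c : Fin (n + 1) → S) (y : ℕ → S) :
    (∀ k ≤ n, y k = extendPath c k) ↔ (fun k : Fin (n + 1) => y k) = c := by
  constructor
  · intro h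
    funext k
    have hk : (k : ℕ) ≤ n := Nat.le_of_lt_succ k.2
    rw [h k hk]
    simp [extendPath, min_eq_left hk]
  · rintro rfl k hk
    simp [extendPath, min_eq_left hk]

variable {S Ω : Type*} [Fintype S] [MeasurableSpace Ω]

/-- A set is partitioned by the first `n + 1` states of a process. -/
theorem measureReal_eq_sum_paths (P : Measure Ω) [IsFiniteMeasure P] (Y : ℕ → Ω → S)
    (hY : ∀ n j, MeasurableSet {ω | Y n ω = j}) (n : ℕ) (E : Set Ω) :
    P.real E = ∑ c : Fin (n + 1) → S, P.real {ω | (∀ k ≤ n, Y k ω = extendPath c k) ∧ ω ∈ E} := by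
  classical
  have hmeas : ∀ c : Fin (n + 1) → S,
      MeasurableSet ((fun ω (k : Fin (n + 1)) => Y k ω) ⁻¹' {c}) := by
    intro c
    have : (fun ω (k : Fin (n + 1)) => Y k ω) ⁻¹' {c} = ⋂ k : Fin (n + 1), {ω | Y k ω = c k} := by
      ext ω
      simp [funext_iff]
    rw [this]
    exact MeasurableSet.iInter fun k => hY _ _
  -- Restricting `P` to `E` lets `E` be non-measurable; only the path cylinders need measurability.
  have h := sum_measure_preimage_singleton (μ := P.restrict E) Finset.univ
    (f := fun ω (k : Fin (n + 1)) => Y k ω) fun c _ => hmeas c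
  simp only [Finset.coe_univ, Set.preimage_univ, Measure.restrict_apply_univ] at h
  rw [Measure.real, ← h, ENNReal.toReal_sum fun c _ => measure_ne_top _ _]
  refine Finset.sum_congr rfl fun c _ => ?_
  rw [Measure.restrict_apply (hmeas c), Measure.real]
  congr 2
  ext ω
  simp [forall_eq_extendPath_iff c fun k => Y k ω]

open Classical in
/-- The probability that a Markov chain does not leave a set during its first `n` steps. -/
noncomputable def stayProb (p : Matrix S S ℝ) (ν : S → ℝ) (A : Set S) (n : ℕ) : ℝ :=
  ∑ c : Fin (n + 1) → S, if ∀ k ≤ n, extendPath c k ∈ A then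
    ν (extendPath c 0) * ∏ k ∈ Finset.range n, p (extendPath c k) (extendPath c (k + 1)) else 0

theorem IsDiscreteMarkovChain.measureReal_stay {p : Matrix S S ℝ} {ν : S → ℝ} {P : Measure Ω}
    [IsFiniteMeasure P] {Y : ℕ → Ω → S} (h : IsDiscreteMarkovChain p ν P Y) (A : Set S) (n : ℕ) :
    P.real {ω | ∀ k ≤ n, Y k ω ∈ A} = stayProb p ν A n := by
  classical
  rw [measureReal_eq_sum_paths P Y h.measurable n, stayProb]
  refine Finset.sum_congr rfl fun c _ => ?_
  split_ifs with hc
  · rw [← h.law]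
    congr 1
    ext ω
    simp only [Set.mem_ofPred_eq, and_iff_left_iff_imp]
    intro hω k hk
    rw [hω k hk]
    exact hc k hk
  · have : {ω | (∀ k ≤ n, Y k ω = extendPath c k) ∧ ω ∈ {ω | ∀ k ≤ n, Y k ω ∈ A}} = ∅ := by
      ext ω
      simp only [Set.mem_ofPred_eq, Set.mem_empty_iff_false, iff_false, not_and]
      intro hω hA
      exact hc fun k hk => hω k hk ▸ hA k hk
    rw [this, measureReal_empty]

/-- Reduces an arbitrary initial law to point masses, the only starts for which absorption of the
limiting chain is known. -/
theorem stayProb_eq_sum_initial [DecidableEq S] (p : Matrix S S ℝ) (ν : S → ℝ) (A : Set S)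
    (n : ℕ) : stayProb p ν A n = ∑ i, ν i * stayProb p (Pi.single i 1) A n := by
  classical
  simp only [stayProb, Finset.mul_sum]
  rw [Finset.sum_comm]
  refine Finset.sum_congr rfl fun c _ => ?_
  split_ifs
  · simp [Pi.single_apply]
  · simp

/-- For fixed `n` this is a finite sum of finite products of entries, so entrywise convergence
suffices. -/
theorem tendsto_stayProb {Q : ℝ → Matrix S S ℝ} {W : Matrix S S ℝ} {l : Filter ℝ}
    (hW : ∀ i j, Tendsto (fun lam => Q lam i j) l (𝓝 (W i j))) (ν : S → ℝ) (A : Set S) (n : ℕ) :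
    Tendsto (fun lam => stayProb (Q lam) ν A n) l (𝓝 (stayProb W ν A n)) := by
  classical
  unfold stayProb
  refine tendsto_finsetSum _ fun c _ => ?_
  split_ifs
  · exact tendsto_const_nhds.mul (tendsto_finsetProd _ fun k _ => hW _ _)
  · exact tendsto_const_nhds

/-- A chain which almost surely reaches `B` stays outside `B` for a long time with small
probability only. -/
theorem IsDiscreteMarkovChain.tendsto_stayProb_compl {p : Matrix S S ℝ} {ν : S → ℝ}
    {P : Measure Ω} [IsProbabilityMeasure P] {Y : ℕ → Ω → S} (h : IsDiscreteMarkovChain p ν P Y)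
    (B : Set S) (hT : P {ω | discretePassageTime B (Y · ω) < ⊤} = 1) :
    Tendsto (fun n => stayProb p ν Bᶜ n) atTop (𝓝 0) := by
  have hYB : ∀ k, MeasurableSet {ω | Y k ω ∈ Bᶜ} := by
    intro k
    have : {ω | Y k ω ∈ Bᶜ} = ⋃ j ∈ Bᶜ, {ω | Y k ω = j} := by
      ext ω
      simp
    rw [this]
    exact MeasurableSet.biUnion (Set.to_countable _) fun j _ => h.measurable k j
  have hmeas : ∀ n, MeasurableSet {ω | ∀ k ≤ n, Y k ω ∈ Bᶜ} := by
    intro n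
    simp only [Set.ofPred_forall]
    exact MeasurableSet.iInter fun k => MeasurableSet.iInter fun _ => hYB k
  have hanti : Antitone fun n => {ω | ∀ k ≤ n, Y k ω ∈ Bᶜ} :=
    fun m n hmn ω hω k hk => hω k (hk.trans hmn)
  have hset : {ω | discretePassageTime B (Y · ω) < ⊤} = (⋂ n, {ω | ∀ k ≤ n, Y k ω ∈ Bᶜ})ᶜ := by
    ext ω
    simp only [Set.mem_ofPred_eq, discretePassageTime, Set.mem_compl_iff, Set.mem_iInter,
      iInf_lt_iff]
    constructor
    · rintro ⟨n, hn, -⟩ hall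
      exact hall n n le_rfl hn
    · intro hn
      push Not at hn
      obtain ⟨_, k, -, hk⟩ := hn
      exact ⟨k, hk, ENat.natCast_lt_top k⟩
  have hinter : MeasurableSet (⋂ n, {ω | ∀ k ≤ n, Y k ω ∈ Bᶜ}) := MeasurableSet.iInter hmeas
  rw [hset, prob_compl_eq_one_iff hinter] at hT
  have hlim := tendsto_measure_iInter_atTop (μ := P) (fun n => (hmeas n).nullMeasurableSet) hanti
    ⟨0, measure_ne_top _ _⟩
  rw [hT] at hlim
  have := (ENNReal.tendsto_toReal ENNReal.zero_ne_top).comp hlim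
  refine this.congr fun n => ?_
  rw [← h.measureReal_stay Bᶜ n]
  rfl

end Paths

/-! ### Deterministic analysis of a single path -/

section SamplePath

variable {S : Type*} (x : ℝ≥0 → S)

theorem eq_jumpChain {n : ℕ} {t : ℝ≥0} (h₁ : jumpTime x n ≤ t)
    (h₂ : (t : ℝ≥0∞) < jumpTime x (n + 1)) :
    x t = jumpChain x n := by
  by_contra h
  refine h₂.not_ge ?_
  rw [jumpTime]
  exact iInf₂_le t ⟨h₁, h⟩

theorem jumpTime_le_mul {s : ℝ≥0} {n : ℕ} (h : ∀ k < n, holdingTime x k ≤ s) :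
    jumpTime x n ≤ n * s := by
  induction n with
  | zero => simp [jumpTime]
  | succ n ih =>
    have h₁ := ih fun k hk => h k (hk.trans n.lt_succ_self)
    have h₂ := h n n.lt_succ_self
    rw [holdingTime, tsub_le_iff_left] at h₂
    calc jumpTime x (n + 1) ≤ jumpTime x n + s := h₂
      _ ≤ n * s + s := by gcongr
      _ = (n + 1 : ℕ) * s := by push_cast; ring

theorem notMem_of_lt_jumpTime {B : Set S} {n : ℕ} (h : ∀ k < n, jumpChain x k ∉ B) {t : ℝ≥0}
    (ht : (t : ℝ≥0∞) < jumpTime x n) : x t ∉ B := by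
  induction n with
  | zero => simp [jumpTime] at ht
  | succ n ih =>
    rcases lt_or_ge (t : ℝ≥0∞) (jumpTime x n) with hlt | hge
    · exact ih (fun k hk => h k (hk.trans n.lt_succ_self)) hlt
    · rw [eq_jumpChain x hge ht]
      exact h n n.lt_succ_self

theorem passageTime_eq_jumpTime {B : Set S} {n : ℕ} (h : ∀ k < n, jumpChain x k ∉ B)
    (hn : jumpChain x n ∈ B) (hfin : jumpTime x n ≠ ⊤) : passageTime B x = jumpTime x n := by
  apply le_antisymm
  · calc passageTime B x ≤ ((jumpTime x n).toNNReal : ℝ≥0∞) :=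
          iInf₂_le (f := fun (t : ℝ≥0) (_ : x t ∈ B) => (t : ℝ≥0∞)) (jumpTime x n).toNNReal hn
      _ = jumpTime x n := ENNReal.coe_toNNReal hfin
  · refine le_iInf₂ fun t ht => ?_
    by_contra hlt
    exact notMem_of_lt_jumpTime x h (not_le.mp hlt) ht

/-- If the path enters `B` within its first `N` jumps, having held shortly outside `B`, and then
holds longer than `t`, then at time `t` it still is where it entered `B`. -/
theorem eq_at_passageTime {B : Set S} {N : ℕ} {s t : ℝ≥0} (hst : N * s ≤ t)
    (hreach : ∃ k ≤ N, jumpChain x k ∈ B)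
    (hfast : ∀ k ≤ N, jumpChain x k ∉ B → holdingTime x k ≤ s)
    (hslow : ∀ k ≤ N, jumpChain x k ∈ B → t < holdingTime x k) :
    passageTime B x < ⊤ ∧ x (passageTime B x).toNNReal = x t ∧ x t ∈ B := by
  classical
  obtain ⟨hnN, hnB⟩ := Nat.find_spec hreach
  set n := Nat.find hreach
  have hbefore : ∀ k < n, jumpChain x k ∉ B := fun k hk hkB =>
    Nat.find_min hreach hk ⟨hk.le.trans hnN, hkB⟩
  -- The `n ≤ N` visits before entrance are all outside `B`, hence last at most `s` each.
  have hJ : jumpTime x n ≤ t := by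
    calc jumpTime x n ≤ n * s :=
          jumpTime_le_mul x fun k hk => hfast k (hk.le.trans hnN) (hbefore k hk)
      _ ≤ N * s := by gcongr
      _ ≤ t := by exact_mod_cast hst
  have hfin : jumpTime x n ≠ ⊤ := ne_top_of_le_ne_top ENNReal.coe_ne_top hJ
  have hnext : (t : ℝ≥0∞) < jumpTime x (n + 1) := (hslow n hnN hnB).trans_le tsub_le_self
  have hxt := eq_jumpChain x hJ hnext
  rw [passageTime_eq_jumpTime x hbefore hnB hfin, hxt]
  exact ⟨hfin.lt_top, rfl, hnB⟩

end SamplePath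

/-! ### Exponential holding times and the union bound -/

section HoldingTimes

variable {S Ω : Type*} [Fintype S] [DecidableEq S] [MeasurableSpace Ω] {q : Matrix S S ℝ}
  {ν : S → ℝ} {P : Measure Ω} [IsProbabilityMeasure P] {X : ℝ≥0 → Ω → S}

/-- Take all thresholds 0 in the joint law: the exponential factors become 1. This allows inactive
constraints to be written as `0 < holdingTime`. -/
theorem IsMarkovChain.ae_holdingTime_pos (h : IsMarkovChain q ν P X) (n : ℕ) :
    ∀ᵐ ω ∂P, ∀ k ≤ n, 0 < holdingTime (X · ω) k := by
  have hY := h.jumpChain_law.measurable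
  have hmeas : MeasurableSet {ω | ∀ k ≤ n, 0 < holdingTime (X · ω) k} := by
    simp only [Set.ofPred_forall]
    exact MeasurableSet.iInter fun k => MeasurableSet.iInter fun _ =>
      measurableSet_lt measurable_const (h.measurable_holdingTime k)
  have hsum := measureReal_eq_sum_paths P _ hY n {ω | ∀ k ≤ n, 0 < holdingTime (X · ω) k}
  have htot := measureReal_eq_sum_paths P _ hY n Set.univ
  rw [probReal_univ] at htot
  have hone : P.real {ω | ∀ k ≤ n, 0 < holdingTime (X · ω) k} = 1 := by
    rw [hsum, htot]
    refine Finset.sum_congr rfl fun c _ => ?_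
    have hlaw := h.holdingTime_law n (extendPath c) 0
    simp only [Pi.zero_apply, NNReal.coe_zero, mul_zero, neg_zero, Real.exp_zero,
      Finset.prod_const_one, mul_one, ENNReal.coe_zero, forall₂_and] at hlaw
    simpa using hlaw
  refine (mem_ae_iff_prob_eq_one hmeas).mpr ?_
  rwa [Measure.real, ENNReal.toReal_eq_one_iff] at hone

/-- Conditionally on the state, a holding time is exponential. -/
theorem IsMarkovChain.measureReal_lt_holdingTime (h : IsMarkovChain q ν P X) (n : ℕ) (a : S)
    (s : ℝ≥0) :
    P.real {ω | jumpChain (X · ω) n = a ∧ s < holdingTime (X · ω) n} =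
      P.real {ω | jumpChain (X · ω) n = a} * Real.exp (-(exitRate q a * s)) := by
  have hY := h.jumpChain_law.measurable
  rw [measureReal_eq_sum_paths P _ hY n, measureReal_eq_sum_paths P _ hY n
    {ω | jumpChain (X · ω) n = a}, Finset.sum_mul]
  refine Finset.sum_congr rfl fun c _ => ?_
  by_cases hc : extendPath c n = a
  -- Threshold 0 at the earlier steps imposes no condition almost surely, so only the `n`-th
  -- exponential factor survives.
  · have hlaw := h.holdingTime_law n (extendPath c) fun k => if k = n then s else 0
    rw [Finset.prod_range_succ, Finset.prod_eq_one, one_mul, if_pos rfl, hc] at hlaw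
    · convert hlaw using 1
      · apply measureReal_congr
        filter_upwards [h.ae_holdingTime_pos n] with ω hω
        apply propext
        constructor
        · rintro ⟨h₁, -, h₂⟩ k hk
          refine ⟨h₁ k hk, ?_⟩
          split_ifs with hkn
          · rwa [hkn]
          · exact_mod_cast hω k hk
        · intro hk
          refine ⟨fun k hkn => (hk k hkn).1, (hk n le_rfl).1.trans hc, ?_⟩
          simpa using (hk n le_rfl).2
      · congr 2
        ext ω
        simp only [Set.mem_ofPred_eq, and_iff_left_iff_imp]
        exact fun hω => (hω n le_rfl).trans hc
    · intro k hk
      simp [(Finset.mem_range.mp hk).ne]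
  · have h₁ : ∀ E : Set Ω, {ω | (∀ k ≤ n, jumpChain (X · ω) k = extendPath c k) ∧
        ω ∈ {ω | jumpChain (X · ω) n = a} ∩ E} = ∅ := by
      intro E
      ext ω
      simp only [Set.mem_ofPred_eq, Set.mem_inter_iff, Set.mem_empty_iff_false, iff_false, not_and]
      exact fun hω ha => (hc ((hω n le_rfl).symm.trans ha)).elim
    have h₂ := h₁ Set.univ
    rw [Set.inter_univ] at h₂
    rw [h₂, measureReal_empty, zero_mul]
    exact (congrArg P.real (h₁ _)).trans measureReal_empty

theorem IsMarkovChain.measureReal_holdingTime_gt_le (h : IsMarkovChain q ν P X) (n : ℕ) (a : S)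
    (s : ℝ≥0) :
    P.real {ω | jumpChain (X · ω) n = a ∧ s < holdingTime (X · ω) n} ≤
      Real.exp (-(exitRate q a * s)) := by
  rw [h.measureReal_lt_holdingTime]
  exact mul_le_of_le_one_left (Real.exp_pos _).le measureReal_le_one

theorem IsMarkovChain.measureReal_holdingTime_le_le (h : IsMarkovChain q ν P X) (n : ℕ) (a : S)
    (s : ℝ≥0) (ha : 0 ≤ exitRate q a) :
    P.real {ω | jumpChain (X · ω) n = a ∧ holdingTime (X · ω) n ≤ s} ≤
      1 - Real.exp (-(exitRate q a * s)) := by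
  have hY := h.jumpChain_law.measurable n a
  have hm : MeasurableSet {ω | (s : ℝ≥0∞) < holdingTime (X · ω) n} :=
    measurableSet_lt measurable_const (h.measurable_holdingTime n)
  have hsplit := measureReal_inter_add_sdiff (μ := P) (s := {ω | jumpChain (X · ω) n = a}) hm
  have hdiff : {ω | jumpChain (X · ω) n = a} \ {ω | (s : ℝ≥0∞) < holdingTime (X · ω) n} =
      {ω | jumpChain (X · ω) n = a ∧ holdingTime (X · ω) n ≤ s} := by
    ext ω
    simp
  have hinter := h.measureReal_lt_holdingTime n a s
  rw [Set.ofPred_and] at hinter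
  rw [hdiff, hinter] at hsplit
  have hexp : Real.exp (-(exitRate q a * s)) ≤ 1 :=
    Real.exp_le_one_iff.mpr (neg_nonpos.mpr (mul_nonneg ha s.2))
  have hle : P.real {ω | jumpChain (X · ω) n = a} ≤ 1 := measureReal_le_one
  nlinarith

open Classical in
/-- A bound for the probability that the chain does not enter `B` within `N` jumps, or holds for
longer than `s` outside `B`, or not longer than `t` in `B`. -/
noncomputable def entranceErrorBound (q : Matrix S S ℝ) (ν : S → ℝ) (B : Set S) (N : ℕ) (s t : ℝ≥0) : ℝ :=
  stayProb (jumpMatrix q) ν Bᶜ N + ∑ _k ∈ Finset.range (N + 1), ∑ a : S,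
    if a ∈ B then 1 - Real.exp (-(exitRate q a * t)) else Real.exp (-(exitRate q a * s))

/-- Outside a set of small probability, the chain is at time `t` where it entered `B`. -/
theorem IsMarkovChain.exists_measureReal_le (h : IsMarkovChain q ν P X) (B : Set S) (N : ℕ)
    {s t : ℝ≥0} (hst : N * s ≤ t) (hq : ∀ a, 0 ≤ exitRate q a) :
    ∃ D : Set Ω, P.real D ≤ entranceErrorBound q ν B N s t ∧ ∀ ω ∉ D,
      passageTime B (X · ω) < ⊤ ∧ X (passageTime B (X · ω)).toNNReal ω = X t ω ∧ X t ω ∈ B := by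
  classical
  -- The bad event at step `k` in state `a`: too short a stay if `a` lies in `B`, too long a stay
  -- otherwise.
  let E : ℕ → S → Set Ω := fun k a => if a ∈ B then
    {ω | jumpChain (X · ω) k = a ∧ holdingTime (X · ω) k ≤ t} else
    {ω | jumpChain (X · ω) k = a ∧ s < holdingTime (X · ω) k}
  refine ⟨{ω | ∀ k ≤ N, jumpChain (X · ω) k ∈ Bᶜ} ∪
    ⋃ k ∈ Finset.range (N + 1), ⋃ a ∈ (Finset.univ : Finset S), E k a, ?_, ?_⟩
  · refine (measureReal_union_le _ _).trans (add_le_add (h.jumpChain_law.measureReal_stay _ _).le ?_)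
    refine (measureReal_biUnion_finset_le _ _).trans (Finset.sum_le_sum fun k _ => ?_)
    refine (measureReal_biUnion_finset_le _ _).trans (Finset.sum_le_sum fun a _ => ?_)
    by_cases ha : a ∈ B
    · simp only [E, if_pos ha]
      exact h.measureReal_holdingTime_le_le k a t (hq a)
    · simp only [E, if_neg ha]
      exact h.measureReal_holdingTime_gt_le k a s
  · intro ω hω
    simp only [Set.mem_union, Set.mem_ofPred_eq, Set.mem_iUnion, Finset.mem_range, Finset.mem_univ,
      exists_prop, true_and, not_or, not_exists, not_and] at hω
    obtain ⟨h₁, h₂⟩ := hω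
    push Not at h₁
    refine eq_at_passageTime (X · ω) hst ?_ ?_ ?_
    · obtain ⟨k, hk, hkB⟩ := h₁
      exact ⟨k, hk, not_not.mp hkB⟩
    · intro k hk hkB
      have := h₂ k (Nat.lt_succ_of_le hk) (jumpChain (X · ω) k)
      simp only [E, if_neg hkB] at this
      exact not_lt.mp fun hlt => this ⟨rfl, hlt⟩
    · intro k hk hkB
      have := h₂ k (Nat.lt_succ_of_le hk) (jumpChain (X · ω) k)
      simp only [E, if_pos hkB] at this
      exact not_le.mp fun hle => this ⟨rfl, hle⟩

/-- The laws at time `t` and at the entrance into `B` are close. -/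
theorem IsMarkovChain.dTV_marginalLaw_firstPassageLaw_le (h : IsMarkovChain q ν P X) (B : Set S)
    (N : ℕ) {s t : ℝ≥0} (hst : N * s ≤ t) (hq : ∀ a, 0 ≤ exitRate q a) :
    dTV (marginalLaw P X t) (firstPassageLaw P X B) ≤
        Fintype.card S / 2 * entranceErrorBound q ν B N s t ∧
      1 - entranceErrorBound q ν B N s t ≤ P.real {ω | X t ω ∈ B} := by
  obtain ⟨D, hD, hgood⟩ := h.exists_measureReal_le B N hst hq
  constructor
  · have hj : ∀ j, |marginalLaw P X t j - firstPassageLaw P X B j| ≤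
        entranceErrorBound q ν B N s t := by
      intro j
      rw [abs_sub_le_iff, sub_le_iff_le_add', sub_le_iff_le_add']
      constructor
      · refine (measureReal_mono (fun ω hω => ?_)).trans
          ((measureReal_union_le _ D).trans (add_le_add_right hD _))
        by_cases hωD : ω ∈ D
        · exact Or.inr hωD
        · exact Or.inl ⟨(hgood ω hωD).1, (hgood ω hωD).2.1.trans hω⟩
      · refine (measureReal_mono (fun ω hω => ?_)).trans
          ((measureReal_union_le _ D).trans (add_le_add_right hD _))
        by_cases hωD : ω ∈ D
        · exact Or.inr hωD
        · exact Or.inl ((hgood ω hωD).2.1.symm.trans hω.2)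
    have hsum := Finset.sum_le_card_nsmul Finset.univ _ _ fun j _ => hj j
    rw [nsmul_eq_mul, Finset.card_univ] at hsum
    rw [dTV]
    linarith
  · have huniv : P.real Set.univ ≤ P.real {ω | X t ω ∈ B} + P.real D := by
      refine (measureReal_mono (fun ω _ => ?_)).trans (measureReal_union_le _ D)
      by_cases hωD : ω ∈ D
      · exact Or.inr hωD
      · exact Or.inl (hgood ω hωD).2.2
    rw [probReal_univ] at huniv
    linarith

end HoldingTimes

/-! ### Choice of the time scale and limits of the error bound -/

section Limits

variable {S : Type*} [Fintype S]

theorem IsRateMatrix.exitRate_eq_sum [DecidableEq S] {q : Matrix S S ℝ} (h : IsRateMatrix q)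
    (i : S) : exitRate q i = ∑ j ∈ Finset.univ.erase i, q i j := by
  have := h.2 i
  rw [← Finset.add_sum_erase _ _ (Finset.mem_univ i)] at this
  rw [exitRate]
  linarith

theorem IsRateMatrix.exitRate_nonneg {q : Matrix S S ℝ} (h : IsRateMatrix q) (i : S) :
    0 ≤ exitRate q i := by
  classical
  rw [h.exitRate_eq_sum]
  exact Finset.sum_nonneg fun j hj => h.1 i j (Finset.ne_of_mem_erase hj).symm

/-- Every state is slow or fast. -/
theorem mem_fastStates_of_notMem_slowStates {Q : ℝ → Matrix S S ℝ}
    (hQ : ∀ lam > 0, IsRateMatrix (Q lam))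
    (hlim : ∀ i j, i ≠ j → (∃ l : ℝ, Tendsto (fun lam => Q lam i j) atTop (𝓝 l)) ∨
      Tendsto (fun lam => Q lam i j) atTop atTop) {i : S} (hi : i ∉ slowStates Q) :
    i ∈ fastStates Q := by
  classical
  by_cases hex : ∃ j, i ≠ j ∧ Tendsto (fun lam => Q lam i j) atTop atTop
  · obtain ⟨j, hij, hj⟩ := hex
    refine tendsto_atTop_mono' _ ?_ hj
    filter_upwards [eventually_gt_atTop 0] with lam hlam
    rw [(hQ lam hlam).exitRate_eq_sum]
    exact Finset.single_le_sum (f := fun j => Q lam i j)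
      (fun k hk => (hQ lam hlam).1 i k (Finset.ne_of_mem_erase hk).symm)
      (Finset.mem_erase.mpr ⟨hij.symm, Finset.mem_univ j⟩)
  -- If all rates out of `i` have finite limits, so does their sum, and `i` would be slow.
  · push Not at hex
    have hfin : ∀ j, ∃ l : ℝ, i ≠ j → Tendsto (fun lam => Q lam i j) atTop (𝓝 l) := by
      intro j
      by_cases hij : i = j
      · exact ⟨0, fun h => (h hij).elim⟩
      · obtain ⟨l, hl⟩ := (hlim i j hij).resolve_right (hex j hij)
        exact ⟨l, fun _ => hl⟩
    choose l hl using hfin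
    refine (hi ⟨∑ j ∈ Finset.univ.erase i, l j, ?_⟩).elim
    refine (tendsto_finsetSum _ fun j hj => hl j (Finset.ne_of_mem_erase hj).symm).congr' ?_
    filter_upwards [eventually_gt_atTop 0] with lam hlam
    exact ((hQ lam hlam).exitRate_eq_sum i).symm

open Classical in
/-- A time scale which vanishes, but slower than the mean holding time in any fast state. -/
noncomputable def observationTime (Q : ℝ → Matrix S S ℝ) (lam : ℝ) : ℝ≥0 :=
  NNReal.sqrt (Real.toNNReal |lam|⁻¹ +
    ∑ i with i ∈ fastStates Q, Real.toNNReal |exitRate (Q lam) i|⁻¹)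

/-- The summand `|lam|⁻¹` ensures positivity even when there are no fast states. -/
theorem observationTime_pos (Q : ℝ → Matrix S S ℝ) {lam : ℝ} (h : 0 < lam) :
    0 < observationTime Q lam := by
  classical
  rw [observationTime, NNReal.sqrt_pos]
  refine add_pos_of_pos_of_nonneg (Real.toNNReal_pos.mpr (by positivity)) zero_le

theorem tendsto_observationTime (Q : ℝ → Matrix S S ℝ) :
    Tendsto (observationTime Q) atTop (𝓝 0) := by
  classical
  have hinv : ∀ f : ℝ → ℝ, Tendsto f atTop atTop →
      Tendsto (fun lam => Real.toNNReal |f lam|⁻¹) atTop (𝓝 0) := by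
    intro f hf
    have := (tendsto_abs_atTop_atTop.comp hf).inv_tendsto_atTop
    have h := (continuous_real_toNNReal.tendsto 0).comp this
    rw [Real.toNNReal_zero] at h
    exact h
  have h := (hinv _ tendsto_id).add (tendsto_finsetSum
    (Finset.univ.filter fun i => i ∈ fastStates Q)
    fun i hi => hinv _ (Finset.mem_filter.mp hi).2)
  simp only [Finset.sum_const_zero, add_zero] at h
  have hsqrt := (NNReal.continuous_sqrt.tendsto 0).comp h
  rw [NNReal.sqrt_zero] at hsqrt
  exact hsqrt

/-- The square root gives `observationTime ≥ q_i ^ (-1/2)` once `q_i > 0`, so the product is at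
least `√q_i`. -/
theorem tendsto_exitRate_mul_observationTime {Q : ℝ → Matrix S S ℝ} {i : S}
    (hi : i ∈ fastStates Q) :
    Tendsto (fun lam => exitRate (Q lam) i * observationTime Q lam) atTop atTop := by
  classical
  refine tendsto_atTop_mono' _ ?_ (Real.tendsto_sqrt_atTop.comp hi)
  filter_upwards [Tendsto.eventually_gt_atTop hi 0] with lam hlam
  have hle : Real.toNNReal |exitRate (Q lam) i|⁻¹ ≤ Real.toNNReal |lam|⁻¹ +
      ∑ i with i ∈ fastStates Q, Real.toNNReal |exitRate (Q lam) i|⁻¹ :=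
    le_add_of_nonneg_of_le zero_le (Finset.single_le_sum
      (f := fun i => Real.toNNReal |exitRate (Q lam) i|⁻¹) (fun _ _ => zero_le)
      (Finset.mem_filter.mpr ⟨Finset.mem_univ i, hi⟩))
  have hsqrt : (Real.sqrt (exitRate (Q lam) i))⁻¹ ≤ observationTime Q lam := by
    rw [← Real.sqrt_inv, observationTime, Real.coe_sqrt]
    refine Real.sqrt_le_sqrt ?_
    have := NNReal.coe_le_coe.mpr hle
    rwa [Real.coe_toNNReal _ (by positivity), abs_of_pos hlam] at this
  have hpos : 0 < Real.sqrt (exitRate (Q lam) i) := Real.sqrt_pos.mpr hlam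
  calc Real.sqrt (exitRate (Q lam) i)
      = exitRate (Q lam) i * (Real.sqrt (exitRate (Q lam) i))⁻¹ := by
        rw [← div_eq_mul_inv, Real.div_sqrt]
    _ ≤ _ := by gcongr

theorem tendsto_entranceErrorBound [DecidableEq S] {Q : ℝ → Matrix S S ℝ} {W : Matrix S S ℝ}
    (hfast : ∀ i ∉ slowStates Q, i ∈ fastStates Q)
    (hW : ∀ i j, Tendsto (fun lam => jumpMatrix (Q lam) i j) atTop (𝓝 (W i j))) (ν : S → ℝ)
    (N : ℕ) :
    Tendsto (fun lam => entranceErrorBound (Q lam) ν (slowStates Q) N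
      (observationTime Q lam / (N + 1)) (observationTime Q lam)) atTop
      (𝓝 (stayProb W ν (slowStates Q)ᶜ N)) := by
  classical
  have hobs : Tendsto (fun lam => (observationTime Q lam : ℝ)) atTop (𝓝 0) :=
    NNReal.tendsto_coe.mpr (tendsto_observationTime Q)
  have hsum := tendsto_finsetSum (Finset.range (N + 1)) fun (_ : ℕ) _ =>
    tendsto_finsetSum (Finset.univ : Finset S) fun a _ =>
      show Tendsto (fun lam => if a ∈ slowStates Q then
        1 - Real.exp (-(exitRate (Q lam) a * (observationTime Q lam : ℝ))) else
        Real.exp (-(exitRate (Q lam) a * (observationTime Q lam / (N + 1) : ℝ≥0)))) atTop (𝓝 0) by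
    split_ifs with ha
    · obtain ⟨l, hl⟩ := ha
      have := ((Real.continuous_exp.tendsto _).comp (hl.mul hobs).neg).const_sub 1
      simpa using this
    · refine Real.tendsto_exp_neg_atTop_nhds_zero.comp ?_
      have := (tendsto_exitRate_mul_observationTime (hfast a ha)).atTop_div_const
        (show (0 : ℝ) < N + 1 by positivity)
      refine this.congr fun lam => ?_
      push_cast
      ring
  simp only [Finset.sum_const_zero] at hsum
  have h := (tendsto_stayProb hW ν (slowStates Q)ᶜ N).add hsum
  rw [add_zero] at h
  refine h.congr fun lam => ?_
  unfold entranceErrorBound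
  congr!

end Limits

end TwoTimeScale

theorem theorem4 {S : Type*} [Fintype S] [DecidableEq S]
    -- the rate matrices, their limits, and the limiting jump matrix
    (Q : ℝ → Matrix S S ℝ)
    (hQ : ∀ lam > 0, IsRateMatrix (Q lam))
    (hirr : ∀ lam > 0, IsIrreducibleRate (Q lam))
    (hlim : ∀ i j, i ≠ j → (∃ l : ℝ, Tendsto (fun lam => Q lam i j) atTop (𝓝 l)) ∨
      Tendsto (fun lam => Q lam i j) atTop atTop)
    (hB : (slowStates Q).Nonempty)
    (hpos : ∀ (i : S) (l : ℝ), Tendsto (fun lam => exitRate (Q lam) i) atTop (𝓝 l) → 0 < l)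
    (W : Matrix S S ℝ)
    (hW : ∀ i j, Tendsto (fun lam => jumpMatrix (Q lam) i j) atTop (𝓝 (W i j)))
    -- the limiting jump chain, started from any state, and its passage into the slow states
    {Ω₀ : Type*} [MeasurableSpace Ω₀] (P₀ : S → Measure Ω₀) [∀ i, IsProbabilityMeasure (P₀ i)]
    (η : ℕ → Ω₀ → S)
    (hη : ∀ i, IsDiscreteMarkovChain W (Pi.single i 1) (P₀ i) η)
    (hT : ∀ i ∈ fastStates Q, P₀ i {ω | discretePassageTime (slowStates Q) (η · ω) < ⊤} = 1)
    -- the initial law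
    (π : S → ℝ) (hπ : π ∈ stdSimplex ℝ S)
    (ε : ℝ) (hε : 0 < ε) :
    ∃ t : ℝ → ℝ≥0, (∀ lam > 0, 0 < t lam) ∧ Tendsto t atTop (𝓝 0) ∧
      ∀ᶠ lam in atTop, ∀ (Ω : Type*) [MeasurableSpace Ω] (P : Measure Ω) [IsProbabilityMeasure P]
        (X : ℝ≥0 → Ω → S), IsMarkovChain (Q lam) π P X →
          dTV (marginalLaw P X (t lam)) (firstPassageLaw P X (slowStates Q)) ≤ ε ∧
          1 - ε ≤ P.real {ω | X (t lam) ω ∈ slowStates Q} := by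
  have hfast : ∀ i ∉ slowStates Q, i ∈ fastStates Q := fun i hi =>
    mem_fastStates_of_notMem_slowStates hQ hlim hi
  refine ⟨observationTime Q, fun lam hlam => observationTime_pos Q hlam,
    tendsto_observationTime Q, ?_⟩
  have hstay : Tendsto (fun n => stayProb W π (slowStates Q)ᶜ n) atTop (𝓝 0) := by
    have hi : ∀ i, Tendsto (fun n => stayProb W (Pi.single i 1) (slowStates Q)ᶜ n) atTop (𝓝 0) := by
      intro i
      refine (hη i).tendsto_stayProb_compl (slowStates Q) ?_
      by_cases hiB : i ∈ slowStates Q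
      -- From a slow start the passage time is 0 almost surely; `hT` covers only fast starts.
      · have hlaw := (hη i).law 0 fun _ => i
        simp only [nonpos_iff_eq_zero, forall_eq, Pi.single_eq_same, Finset.range_zero,
          Finset.prod_empty, mul_one] at hlaw
        rw [Measure.real, ENNReal.toReal_eq_one_iff] at hlaw
        refine le_antisymm prob_le_one (hlaw.symm.le.trans ?_)
        refine measure_mono fun ω (hω : η 0 ω = i) => ?_
        have h0 : η 0 ω ∈ slowStates Q := hω.symm ▸ hiB
        exact (iInf₂_le (f := fun (n : ℕ) (_ : η n ω ∈ slowStates Q) => (n : ℕ∞)) 0 h0).trans_lt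
          (ENat.natCast_lt_top 0)
      · exact hT i (hfast i hiB)
    have hsum := tendsto_finsetSum Finset.univ fun i _ => (hi i).const_mul (π i)
    simp only [mul_zero, Finset.sum_const_zero] at hsum
    exact hsum.congr fun n => (stayProb_eq_sum_initial W π _ n).symm
  have hcard : 1 ≤ (Fintype.card S : ℝ) := by
    obtain ⟨i, -⟩ := hB
    exact_mod_cast Fintype.card_pos_iff.mpr ⟨i⟩
  -- The total variation estimate sums one error bound per state, hence the division; since `card S
  -- ≥ 1`, the error bound itself also stays below `ε`.
  have hδ : 0 < ε / Fintype.card S := by positivity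
  obtain ⟨N, hN⟩ := (hstay.eventually_lt_const hδ).exists
  filter_upwards [eventually_gt_atTop 0,
    (tendsto_entranceErrorBound hfast hW π N).eventually_lt_const hN] with lam hlam hbound
  intro Ω _ P _ X hX
  have hst : (N : ℝ≥0) * (observationTime Q lam / (N + 1)) ≤ observationTime Q lam := by
    rw [mul_div_left_comm]
    refine mul_le_of_le_one_right zero_le ?_
    exact div_le_one_of_le₀ (le_add_of_nonneg_right zero_le_one) zero_le
  obtain ⟨h₁, h₂⟩ := hX.dTV_marginalLaw_firstPassageLaw_le (slowStates Q) N hst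
    (hQ lam hlam).exitRate_nonneg
  rw [lt_div_iff₀ (by positivity)] at hbound
  have hnonneg : 0 ≤ entranceErrorBound (Q lam) π (slowStates Q) N
      (observationTime Q lam / (N + 1)) (observationTime Q lam) := by
    have : P.real {ω | X (observationTime Q lam) ω ∈ slowStates Q} ≤ 1 := measureReal_le_one
    linarith
  constructor
  · nlinarith
  · nlinarith
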